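/- Consider the planar system $\dot x=y,\ \dot y=ax^m+bx^ny$ with $a,b\in\mathbb R$, $m$ even and $m<2n+1$, and suppose that the origin is a nilpotent cusp of it, that is, an isolated singular point with nonzero nilpotent linear part whose local phase portrait is topologically that of $\dot x=y,\ \dot y=x^2$ (two hyperbolic sectors and two separatrices). Then the unit-time map (the time-one map of the flow) is defined near the origin. Let $U=(U_1,U_2)$ be the unit-time map near the origin, let $y=f(x)$, $f(0)=0$, be the characteristic curve, that is, the curve through the origin on which $\dot x=0$ (here $f\equiv 0$ near $0$), and let $C_h(x)=U_1(x,f(x))$ be the characteristic map. Then $$C_h(x)=x+\frac a2x^m+O(x^{m+1}),\qquad x\to0.$$ Moreover, for every integer $k\ge1$ the following are equivalent: (i) $C_h(x)=x+\frac a2x^k+O(x^{k+1})$ as $x\to 0$, and the characteristic box dimension is $\dim_{ch}U=1-\frac1k$; (ii) $\dim_{ch}U=1-\frac1k$; (iii) the origin is a $k$-multiple nilpotent cusp, that is, a nilpotent cusp for which $\dot y$ restricted to the characteristic curve has the form $F(x)=cx^k+O(x^{k+1})$ with $c\ne0$. Here $\dim_{ch}U=d$ means that there is $r>0$ such that from every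 nonzero point of $(-r,r)$ starts an orbit of $C_h$ (of $C_h$ itself, or of its inverse on a side where $0$ is repelling) that stays in $(-r,r)\setminus\{0\}$ and tends to $0$, and every such orbit has box (Minkowski) dimension $d$. -/

import Mathlib

open Set Filter Topology MeasureTheory Asymptotics

noncomputable section

/-- The planar system `x' = y`, `y' = a x ^ m + b x ^ n y`. -/
def cuspField (a b : ℝ) (m n : ℕ) : ℝ × ℝ → ℝ × ℝ :=
  fun p => (p.2, a * p.1 ^ m + b * p.1 ^ n * p.2)

/-! ### Nilpotent cusps -/

/-- `q` is reached from `p` in nonnegative time along a trajectory of `V` that stays in `W`. -/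
def ReachesWithin (V : ℝ × ℝ → ℝ × ℝ) (W : Set (ℝ × ℝ)) (p q : ℝ × ℝ) : Prop :=
  ∃ T : ℝ, 0 ≤ T ∧ ∃ γ : ℝ → ℝ × ℝ, γ 0 = p ∧ γ T = q ∧
    IsIntegralCurveOn γ (fun _ => V) (Icc 0 T) ∧ ∀ t ∈ Icc 0 T, γ t ∈ W

/-- Local topological equivalence at the origin: a homeomorphism between open neighbourhoods of the
origin that fixes the origin and carries positive semi-trajectories of `V` (in the first
neighbourhood) onto positive semi-trajectories of `V'` (in the second one). -/
def LocallyTopologicallyEquivalent (V V' : ℝ × ℝ → ℝ × ℝ) : Prop :=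
  ∃ h : OpenPartialHomeomorph (ℝ × ℝ) (ℝ × ℝ), (0 : ℝ × ℝ) ∈ h.source ∧ h 0 = 0 ∧
    ∀ p ∈ h.source, ∀ q ∈ h.source,
      (ReachesWithin V h.source p q ↔ ReachesWithin V' h.target (h p) (h q))

/-- The origin is an isolated singular point at which the linear part is nilpotent and nonzero. -/
def IsNilpotentSingularPoint (V : ℝ × ℝ → ℝ × ℝ) : Prop :=
  AnalyticAt ℝ V 0 ∧ V 0 = 0 ∧ (∀ᶠ p in 𝓝[≠] (0 : ℝ × ℝ), V p ≠ 0) ∧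
    ∃ L : ℝ × ℝ →L[ℝ] ℝ × ℝ, HasFDerivAt V L 0 ∧ L ≠ 0 ∧ L.comp L = 0

/-- The origin is a nilpotent cusp: a nilpotent singular point whose local phase portrait is that
of the standard cusp `x' = y`, `y' = x ^ 2` (two hyperbolic sectors and two separatrices). -/
def IsNilpotentCusp (V : ℝ × ℝ → ℝ × ℝ) : Prop :=
  IsNilpotentSingularPoint V ∧ LocallyTopologicallyEquivalent V (fun p => (p.2, p.1 ^ 2))

/-! ### Characteristic curve, multiplicity, unit-time map, characteristic map -/

/-- `y = f x` is the characteristic curve: the curve through the origin on which the first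
component of the field vanishes. (Continuity at `0` selects the curve near the point `(0, 0)`.) -/
def IsCharacteristicCurve (V : ℝ × ℝ → ℝ × ℝ) (f : ℝ → ℝ) : Prop :=
  f 0 = 0 ∧ ContinuousAt f 0 ∧ ∀ᶠ x in 𝓝 (0 : ℝ), (V (x, f x)).1 = 0

/-- The origin has multiplicity `k`: on the characteristic curve the second component of the
field is `c x ^ k + O(x ^ (k + 1))` with `c ≠ 0`. -/
def HasMultiplicity (V : ℝ × ℝ → ℝ × ℝ) (k : ℕ) : Prop :=
  ∃ f : ℝ → ℝ, IsCharacteristicCurve V f ∧ ∃ c : ℝ, c ≠ 0 ∧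
    (fun x => (V (x, f x)).2 - c * x ^ k) =O[𝓝 0] fun x => x ^ (k + 1)

/-- The origin is a `k`-multiple nilpotent cusp. -/
def IsMultipleNilpotentCusp (V : ℝ × ℝ → ℝ × ℝ) (k : ℕ) : Prop :=
  IsNilpotentCusp V ∧ HasMultiplicity V k

/-- `U` is a unit-time map of `V` near the origin: for `p` near the origin, the trajectory
that starts at `p` exists up to time `1` and is then at `U p`. -/
def IsUnitTimeMap (V U : ℝ × ℝ → ℝ × ℝ) : Prop :=
  ∀ᶠ p in 𝓝 (0 : ℝ × ℝ), ∃ γ : ℝ → ℝ × ℝ,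
    γ 0 = p ∧ IsIntegralCurveOn γ (fun _ => V) (Icc 0 1) ∧ γ 1 = U p

/-- The characteristic map `x ↦ U₁ (x, f x)`. -/
def characteristicMap (U : ℝ × ℝ → ℝ × ℝ) (f : ℝ → ℝ) : ℝ → ℝ :=
  fun x => (U (x, f x)).1

/-! ### Box dimension of subsets of the line -/

/-- Lower `s`-dimensional Minkowski content of `A ⊆ ℝ`. -/
def lowerMinkowskiContent (s : ℝ) (A : Set ℝ) : ENNReal :=
  liminf (fun ε : ℝ => volume (Metric.thickening ε A) / ENNReal.ofReal (ε ^ (1 - s))) (𝓝[>] 0)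

/-- Upper `s`-dimensional Minkowski content of `A ⊆ ℝ`. -/
def upperMinkowskiContent (s : ℝ) (A : Set ℝ) : ENNReal :=
  limsup (fun ε : ℝ => volume (Metric.thickening ε A) / ENNReal.ofReal (ε ^ (1 - s))) (𝓝[>] 0)

/-- Lower box dimension of a bounded set `A ⊆ ℝ`. -/
def lowerBoxDim (A : Set ℝ) : ℝ := sInf {s : ℝ | 0 < s ∧ lowerMinkowskiContent s A = 0}

/-- Upper box dimension of a bounded set `A ⊆ ℝ`. -/
def upperBoxDim (A : Set ℝ) : ℝ := sInf {s : ℝ | 0 < s ∧ upperMinkowskiContent s A = 0}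

/-- `A` is bounded, its box dimension exists, and it is equal to `d`. -/
def HasBoxDim (A : Set ℝ) (d : ℝ) : Prop :=
  Bornology.IsBounded A ∧ lowerBoxDim A = d ∧ upperBoxDim A = d

/-! ### Characteristic box dimension -/

/-- `x` is a nontrivial orbit of `C` in `(-r, r)` that tends to the fixed point `0`: a forward
orbit on a side of `0` where `C` is attracting, an orbit of the inverse map on a side where `C`
is repelling. -/
def IsOrbitToZero (C : ℝ → ℝ) (r : ℝ) (x : ℕ → ℝ) : Prop :=
  (∀ j, x j ≠ 0 ∧ |x j| < r) ∧ Tendsto x atTop (𝓝 0) ∧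
    ((∀ j, x (j + 1) = C (x j)) ∨ (∀ j, x j = C (x (j + 1))))

/-- The orbits of `C` near `0` have box dimension `d`: in some interval `(-r, r)`, an orbit that
tends to `0` starts at every nonzero point, and each such orbit has box dimension `d`. -/
def HasOrbitBoxDim (C : ℝ → ℝ) (d : ℝ) : Prop :=
  ∃ r : ℝ, 0 < r ∧
    (∀ x₀ : ℝ, x₀ ≠ 0 → |x₀| < r → ∃ x : ℕ → ℝ, x 0 = x₀ ∧ IsOrbitToZero C r x) ∧
    ∀ x : ℕ → ℝ, IsOrbitToZero C r x → HasBoxDim (range x) d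

/-- `C x = x + c x ^ k + O(x ^ (k + 1))` as `x → 0`. -/
def HasExpansion (C : ℝ → ℝ) (c : ℝ) (k : ℕ) : Prop :=
  (fun x => C x - (x + c * x ^ k)) =O[𝓝 0] fun x => x ^ (k + 1)

end

/-! The characteristic curve is the axis `y = 0`. At `(x₀, 0)` the horizontal velocity vanishes and
the acceleration is `a x₀ ^ m`, so to leading order the motion is uniformly accelerated and covers
`a / 2 * x₀ ^ m` in unit time. Since `y = O(x₀ ^ m)` and `n ≥ 1`, the term `b x ^ n y` only enters
at order `m + 1`. This is `exists_displacement_bound`, a bootstrap from Grönwall's inequality.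

For a map `x + c x ^ k + O(x ^ (k + 1))` with `c ≠ 0` and `k ≥ 2`, orbits tending to `0` have gaps
comparable to the `k`-th powers of their terms. Put `ε = δ ^ k`. Terms below about `δ` have gaps
below `ε`, and their neighbourhoods merge into an interval of length of order `δ`. At most about `δ
^ (1 - k)` terms remain, each contributing `2 ε`, so again `O(δ)` in total. The `ε`-neighbourhood
thus has measure of order `ε ^ (1 / k)`, which gives dimension `1 - 1 / k`
(`hasBoxDim_range_of_gaps`).

An isolated singular point forces `a ≠ 0`, so `ẏ = a x ^ m` on the axis makes the multiplicity `m`.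
Each of the conditions to be compared holds exactly for `k = m`. -/

/-! ### Integral curves near an equilibrium -/

/-- A curve whose velocity field is dominated by the norm near the origin grows at most by the
factor `9` in unit time. -/
theorem norm_integralCurve_le {E : Type*} [NormedAddCommGroup E] [NormedSpace ℝ E]
    {V : E → E} {ρ : ℝ} (hV : ∀ p, ‖p‖ ≤ ρ → ‖V p‖ ≤ ‖p‖) {γ : ℝ → E}
    (hγ : IsIntegralCurveOn γ (fun _ => V) (Icc 0 1)) (h0 : 9 * ‖γ 0‖ < ρ) :
    ∀ t ∈ Icc (0 : ℝ) 1, ‖γ t‖ ≤ 9 * ‖γ 0‖ := by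
  have hexp : Real.exp 2 ≤ 9 := by
    have h1 := Real.exp_one_lt_d9
    have h2 : Real.exp 2 = Real.exp 1 * Real.exp 1 := by rw [← Real.exp_add]; norm_num
    have h3 := Real.exp_pos 1
    rw [h2]; nlinarith
  have key : ∀ δ, ‖γ 0‖ < δ → 9 * δ ≤ ρ → ∀ t ∈ Icc (0 : ℝ) 1, ‖γ t‖ ≤ 9 * δ := by
    intro δ hδ hδρ t ht
    have hδ0 : 0 < δ := (norm_nonneg _).trans_lt hδ
    have hle : ∀ s ∈ Icc (0 : ℝ) 1, δ * Real.exp (2 * s) ≤ 9 * δ := by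
      intro s hs
      have : Real.exp (2 * s) ≤ Real.exp 2 := Real.exp_le_exp.2 (by linarith [hs.2])
      nlinarith
    -- The barrier grows at rate 2, strictly above the rate 1 allowed to the curve; `δ > 0` keeps
    -- this strict even when `γ 0 = 0`.
    have := image_norm_le_of_norm_deriv_right_lt_deriv_boundary (f := γ)
      (f' := fun s => V (γ s)) (a := 0) (b := 1) (B := fun s => δ * Real.exp (2 * s))
      (B' := fun s => δ * (Real.exp (2 * s) * (2 * 1))) hγ.continuousOn
      (fun s hs => (hγ s ⟨hs.1, hs.2.le⟩).mono_of_mem_nhdsWithin (Icc_mem_nhdsGE_of_mem hs))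
      (by simpa using hδ.le)
      (fun s => (((hasDerivAt_id s).const_mul 2).exp).const_mul δ)
      (fun s hs hs' => by
        have h1 := hle s ⟨hs.1, hs.2.le⟩
        have h2 := hV (γ s) (by rw [hs']; linarith)
        have h3 : 0 < δ * Real.exp (2 * s) := by positivity
        rw [hs'] at h2
        nlinarith)
    exact (this ht).trans (hle t ht)
  intro t ht
  refine le_of_forall_pos_le_add fun e he => ?_
  have hm : 0 < min (e / 9) (ρ / 9 - ‖γ 0‖) := lt_min (by positivity) (by linarith)
  have := key (‖γ 0‖ + min (e / 9) (ρ / 9 - ‖γ 0‖)) (by linarith)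
    (by linarith [min_le_right (e / 9) (ρ / 9 - ‖γ 0‖)]) t ht
  linarith [min_le_left (e / 9) (ρ / 9 - ‖γ 0‖)]

/-- Trajectories that start near an equilibrium of a slow field exist up to time one. -/
theorem eventually_exists_integralCurveOn {E : Type*} [NormedAddCommGroup E] [NormedSpace ℝ E]
    [CompleteSpace E] {V : E → E} (hV : ContDiffAt ℝ 1 V 0)
    (hslow : ∀ᶠ p in 𝓝 (0 : E), ‖V p‖ ≤ ‖p‖ / 2) :
    ∀ᶠ p in 𝓝 (0 : E), ∃ γ : ℝ → E, γ 0 = p ∧ IsIntegralCurveOn γ (fun _ => V) (Icc 0 1) := by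
  obtain ⟨K, s, hs, hK⟩ := hV.exists_lipschitzOnWith
  obtain ⟨ρ, hρ, hball⟩ := Metric.nhds_basis_closedBall.mem_iff.1 (inter_mem hs hslow)
  -- Starting within `ρ / 2` of the origin with speed at most `ρ / 2`, a curve stays in the ball of
  -- radius `ρ` for unit time.
  have hPL : IsPicardLindelof (fun _ : ℝ => V) (tmin := 0) (tmax := 1) ⟨0, by simp⟩ (0 : E)
      ⟨ρ, hρ.le⟩ ⟨ρ / 2, by positivity⟩ ⟨ρ / 2, by positivity⟩ K :=
    { lipschitzOnWith := fun t _ => hK.mono fun p hp => (hball hp).1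
      continuousOn := fun _ _ => continuousOn_const
      norm_le := fun t _ p hp => by
        have h1 : ‖V p‖ ≤ ‖p‖ / 2 := (hball hp).2
        have h2 : ‖p‖ ≤ ρ := mem_closedBall_zero_iff.1 hp
        show ‖V p‖ ≤ ρ / 2
        linarith
      mul_max_le := by
        show ρ / 2 * max (1 - 0) (0 - 0) ≤ ρ - ρ / 2
        norm_num
        linarith }
  filter_upwards [Metric.closedBall_mem_nhds (0 : E) (half_pos hρ)] with p hp
  exact hPL.exists_eq_forall_mem_Icc_hasDerivWithinAt hp

/-- Endpoints of trajectories that stay in a set where the field is Lipschitz depend on the initial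
points in a Lipschitz way. -/
theorem dist_integralCurve_le {E : Type*} [NormedAddCommGroup E] [NormedSpace ℝ E]
    {V : E → E} {s : Set E} {K : NNReal} (hV : LipschitzOnWith K V s) {γ η : ℝ → E}
    (hγ : IsIntegralCurveOn γ (fun _ => V) (Icc 0 1))
    (hη : IsIntegralCurveOn η (fun _ => V) (Icc 0 1))
    (hγs : ∀ t ∈ Icc (0 : ℝ) 1, γ t ∈ s) (hηs : ∀ t ∈ Icc (0 : ℝ) 1, η t ∈ s) :
    dist (γ 1) (η 1) ≤ Real.exp K * dist (γ 0) (η 0) := by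
  have := dist_le_of_trajectories_ODE_of_mem (v := fun _ => V) (s := fun _ => s) (a := 0) (b := 1)
    (fun _ _ => hV) hγ.continuousOn
    (fun t ht => (hγ t ⟨ht.1, ht.2.le⟩).mono_of_mem_nhdsWithin (Icc_mem_nhdsGE_of_mem ht))
    (fun t ht => hγs t ⟨ht.1, ht.2.le⟩) hη.continuousOn
    (fun t ht => (hη t ⟨ht.1, ht.2.le⟩).mono_of_mem_nhdsWithin (Icc_mem_nhdsGE_of_mem ht))
    (fun t ht => hηs t ⟨ht.1, ht.2.le⟩) le_rfl 1 (by simp)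
  simpa [mul_comm] using this

/-- A curve that starts at `0` with velocity at most `M` has norm at most `M` up to time one. -/
theorem norm_le_of_norm_deriv_le_of_unit_time {g g' : ℝ → ℝ} {M : ℝ} (h0 : g 0 = 0)
    (hg : ∀ t ∈ Icc (0 : ℝ) 1, HasDerivWithinAt g (g' t) (Icc 0 1) t)
    (hM : ∀ t ∈ Icc (0 : ℝ) 1, |g' t| ≤ M) : ∀ t ∈ Icc (0 : ℝ) 1, |g t| ≤ M := by
  intro t ht
  have := (convex_Icc (0 : ℝ) 1).norm_image_sub_le_of_norm_hasDerivWithin_le hg hM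
    (by simp : (0 : ℝ) ∈ Icc (0 : ℝ) 1) ht
  have hM0 : 0 ≤ M := (abs_nonneg _).trans (hM t ht)
  rw [h0, sub_zero, sub_zero, Real.norm_eq_abs, Real.norm_eq_abs, abs_of_nonneg ht.1] at this
  nlinarith [ht.2]

/-! ### The field of the cusp -/

theorem contDiff_cuspField (a b : ℝ) (m n : ℕ) : ContDiff ℝ 1 (cuspField a b m n) := by
  unfold cuspField
  fun_prop

theorem abs_second_cuspField_le (a b : ℝ) {m n : ℕ} (hm : 2 ≤ m) (hn : 1 ≤ n) {p : ℝ × ℝ}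
    (hp : ‖p‖ ≤ 1) : |a * p.1 ^ m + b * p.1 ^ n * p.2| ≤ (|a| + |b|) * ‖p‖ ^ 2 := by
  have h1 : |p.1| ≤ ‖p‖ := norm_fst_le p
  have h2 : |p.2| ≤ ‖p‖ := norm_snd_le p
  have h3 : |p.1| ^ m ≤ ‖p‖ ^ 2 :=
    (pow_le_pow_left₀ (abs_nonneg _) h1 m).trans (pow_le_pow_of_le_one (norm_nonneg _) hp hm)
  have h4 : |p.1| ^ n ≤ ‖p‖ ^ 1 :=
    (pow_le_pow_left₀ (abs_nonneg _) h1 n).trans (pow_le_pow_of_le_one (norm_nonneg _) hp hn)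
  have h5 : |p.1| ^ n * |p.2| ≤ ‖p‖ ^ 1 * ‖p‖ :=
    mul_le_mul h4 h2 (abs_nonneg _) (by positivity)
  calc |a * p.1 ^ m + b * p.1 ^ n * p.2| ≤ |a| * |p.1| ^ m + |b| * (|p.1| ^ n * |p.2|) := by
        refine (abs_add_le _ _).trans (le_of_eq ?_)
        simp only [abs_mul, abs_pow]; ring
    _ ≤ |a| * ‖p‖ ^ 2 + |b| * (‖p‖ ^ 1 * ‖p‖) := by gcongr
    _ = _ := by ring

theorem exists_norm_cuspField_le (a b : ℝ) {m n : ℕ} (hm : 2 ≤ m) (hn : 1 ≤ n) :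
    ∃ ρ : ℝ, 0 < ρ ∧ ρ ≤ 1 ∧ ∀ p, ‖p‖ ≤ ρ → ‖cuspField a b m n p‖ ≤ ‖p‖ := by
  refine ⟨1 / (|a| + |b| + 1), by positivity, ?_, fun p hp => ?_⟩
  · rw [div_le_one (by positivity)]; linarith [abs_nonneg a, abs_nonneg b]
  have h1 : ‖p‖ * (|a| + |b| + 1) ≤ 1 := (le_div_iff₀ (by positivity)).1 hp
  have h0 := norm_nonneg p
  have h2 : ‖p‖ ≤ 1 := by nlinarith [abs_nonneg a, abs_nonneg b]
  refine norm_prod_le_iff.2 ⟨norm_snd_le p, ?_⟩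
  refine (abs_second_cuspField_le a b hm hn h2).trans ?_
  nlinarith

/-- The unit-time map is defined near the origin. -/
theorem exists_isUnitTimeMap_cuspField (a b : ℝ) {m n : ℕ} (hm : 2 ≤ m) (hn : 1 ≤ n) :
    ∃ U, IsUnitTimeMap (cuspField a b m n) U := by
  -- The linear part of the cusp field has norm 1, too fast for the existence lemma. In the
  -- coordinate `Y = 4 y` it has norm 1/4.
  set W : ℝ × ℝ → ℝ × ℝ := fun p => (p.2 / 4, 4 * (a * p.1 ^ m + b * p.1 ^ n * (p.2 / 4))) with hW
  have hWs : ContDiff ℝ 1 W := by rw [hW]; fun_prop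
  have hslow : ∀ᶠ p in 𝓝 (0 : ℝ × ℝ), ‖W p‖ ≤ ‖p‖ / 2 := by
    have hr : (0 : ℝ) < 1 / (8 * (|a| + |b| + 1)) := by positivity
    filter_upwards [Metric.closedBall_mem_nhds (0 : ℝ × ℝ) hr] with p hp
    have hp' : ‖p‖ ≤ 1 / (8 * (|a| + |b| + 1)) := by simpa using hp
    have h1 : ‖p‖ * (8 * (|a| + |b| + 1)) ≤ 1 := (le_div_iff₀ (by positivity)).1 hp'
    have h0 := norm_nonneg p
    have h2 : ‖p‖ ≤ 1 := by nlinarith [abs_nonneg a, abs_nonneg b]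
    have h3 : |p.2| ≤ ‖p‖ := norm_snd_le p
    refine norm_prod_le_iff.2 ⟨?_, ?_⟩
    · show |p.2 / 4| ≤ _
      rw [abs_div, abs_of_pos (by norm_num : (0 : ℝ) < 4)]; linarith
    · show |4 * (a * p.1 ^ m + b * p.1 ^ n * (p.2 / 4))| ≤ _
      have h4 := abs_second_cuspField_le a (b / 4) hm hn h2
      have h5 : a * p.1 ^ m + b * p.1 ^ n * (p.2 / 4) = a * p.1 ^ m + b / 4 * p.1 ^ n * p.2 := by
        ring
      rw [abs_mul, abs_of_pos (by norm_num : (0 : ℝ) < 4), h5]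
      rw [abs_div, abs_of_pos (by norm_num : (0 : ℝ) < 4)] at h4
      nlinarith [abs_nonneg b, mul_nonneg (abs_nonneg b) (sq_nonneg ‖p‖)]
  have hcont : Tendsto (fun p : ℝ × ℝ => (p.1, 4 * p.2)) (𝓝 0) (𝓝 0) := by
    have : Continuous (fun p : ℝ × ℝ => (p.1, 4 * p.2)) := by fun_prop
    exact this.tendsto' 0 0 (by simp)
  have hex : ∀ᶠ p in 𝓝 (0 : ℝ × ℝ), ∃ γ : ℝ → ℝ × ℝ,
      γ 0 = p ∧ IsIntegralCurveOn γ (fun _ => cuspField a b m n) (Icc 0 1) := by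
    filter_upwards [hcont.eventually
      (eventually_exists_integralCurveOn hWs.contDiffAt hslow)] with p ⟨γ, hγ0, hγ⟩
    refine ⟨fun t => ((γ t).1, (γ t).2 / 4), by simp [hγ0], fun t ht => ?_⟩
    have h := hγ t ht
    have h1 : HasDerivWithinAt (fun t => (γ t).1) ((γ t).2 / 4) (Icc 0 1) t := h.fst
    have h2 : HasDerivWithinAt (fun t => (γ t).2)
      (4 * (a * (γ t).1 ^ m + b * (γ t).1 ^ n * ((γ t).2 / 4))) (Icc 0 1) t := h.snd
    have h3 := h1.prodMk (h2.div_const 4)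
    refine h3.congr_deriv (Prod.ext rfl ?_)
    simp only [cuspField]
    ring
  choose! γ hγ using fun p (hp : ∃ γ : ℝ → ℝ × ℝ,
      γ 0 = p ∧ IsIntegralCurveOn γ (fun _ => cuspField a b m n) (Icc 0 1)) => hp
  exact ⟨fun p => γ p 1, hex.mono fun p hp => ⟨γ p, (hγ p hp).1, (hγ p hp).2, rfl⟩⟩

/-- Displacement of a trajectory that starts on the characteristic curve. -/
theorem exists_displacement_bound (a b : ℝ) {m n : ℕ} (hm : 2 ≤ m) (hn : 1 ≤ n) :
    ∃ M r : ℝ, 0 < r ∧ ∀ x₀ : ℝ, |x₀| < r → ∀ γ : ℝ → ℝ × ℝ, γ 0 = (x₀, 0) →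
      IsIntegralCurveOn γ (fun _ => cuspField a b m n) (Icc 0 1) →
      |(γ 1).1 - (x₀ + a / 2 * x₀ ^ m)| ≤ M * |x₀| ^ (m + 1) := by
  obtain ⟨ρ, hρ, hρ1, hslow⟩ := exists_norm_cuspField_le a b hm hn
  set A : ℝ := |a| * 9 ^ m with hA
  set B : ℝ := |b| * 9 ^ n with hB
  have hA0 : 0 ≤ A := by positivity
  have hB0 : 0 ≤ B := by positivity
  -- The bound `ρ / 9` keeps the trajectory in the slow region; `1 / (B + 1)` makes `|b x ^ n| ≤ 1`,
  -- so that Grönwall applies with rate 1.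
  refine ⟨|a| * (m * (9 ^ (m - 1) * (2 * A))) + B * (2 * A), min (ρ / 9) (1 / (B + 1)),
    lt_min (by positivity) (by positivity), fun x₀ hx₀ γ h0 hγ => ?_⟩
  have hx1 : 9 * |x₀| < ρ := by linarith [hx₀.trans_le (min_le_left _ _)]
  have hx2 : |x₀| * (B + 1) ≤ 1 :=
    (le_div_iff₀ (by positivity)).1 (hx₀.trans_le (min_le_right _ _)).le
  have hd0 := abs_nonneg x₀
  set d : ℝ := |x₀| with hd
  have hd1 : d ≤ 1 := by linarith
  have hn0 : ‖γ 0‖ = d := by simp [h0, Prod.norm_def, hd]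
  have hγb : ∀ t ∈ Icc (0 : ℝ) 1, ‖γ t‖ ≤ 9 * d := by
    intro t ht
    rw [← hn0]
    exact norm_integralCurve_le hslow hγ (by rw [hn0]; exact hx1) t ht
  have hxb : ∀ t ∈ Icc (0 : ℝ) 1, |(γ t).1| ≤ 9 * d := fun t ht =>
    (norm_fst_le _).trans (hγb t ht)
  have hx' : ∀ t ∈ Icc (0 : ℝ) 1, HasDerivWithinAt (fun t => (γ t).1) (γ t).2 (Icc 0 1) t :=
    fun t ht => (hγ t ht).fst
  have hy' : ∀ t ∈ Icc (0 : ℝ) 1, HasDerivWithinAt (fun t => (γ t).2)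
      (a * (γ t).1 ^ m + b * (γ t).1 ^ n * (γ t).2) (Icc 0 1) t := fun t ht => (hγ t ht).snd
  have hbn : ∀ t ∈ Icc (0 : ℝ) 1, |b * (γ t).1 ^ n| ≤ B * d := by
    intro t ht
    rw [abs_mul, abs_pow]
    calc |b| * |(γ t).1| ^ n ≤ |b| * (9 * d) ^ n := by gcongr; exact hxb t ht
      _ = B * d ^ n := by rw [mul_pow, hB]; ring
      _ ≤ B * d := by
        gcongr
        simpa using pow_le_pow_of_le_one hd0 hd1 hn
  -- From `|y'| ≤ A d ^ m + |y|` and `y 0 = 0`, `|y| ≤ (e - 1) A d ^ m`. Integration bounds `x -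
  -- x₀`, and feeding both bounds back into `y'` gains one order.
  have hyb : ∀ t ∈ Icc (0 : ℝ) 1, |(γ t).2| ≤ 2 * A * d ^ m := by
    intro t ht
    have := norm_le_gronwallBound_of_norm_deriv_right_le (f := fun t => (γ t).2)
      (f' := fun t => a * (γ t).1 ^ m + b * (γ t).1 ^ n * (γ t).2) (δ := 0) (K := 1)
      (ε := A * d ^ m) (a := 0) (b := 1) (fun t ht => (hy' t ht).continuousWithinAt)
      (fun s hs => (hy' s ⟨hs.1, hs.2.le⟩).mono_of_mem_nhdsWithin (Icc_mem_nhdsGE_of_mem hs))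
      (by simp [h0]) (fun s hs => by
        have hs' : s ∈ Icc (0 : ℝ) 1 := ⟨hs.1, hs.2.le⟩
        have h1 := hbn s hs'
        have h2 : |a * (γ s).1 ^ m| ≤ A * d ^ m := by
          rw [abs_mul, abs_pow]
          calc |a| * |(γ s).1| ^ m ≤ |a| * (9 * d) ^ m := by gcongr; exact hxb s hs'
            _ = A * d ^ m := by rw [mul_pow, hA]; ring
        have h3 : |b * (γ s).1 ^ n * (γ s).2| ≤ 1 * |(γ s).2| := by
          rw [abs_mul]
          exact mul_le_mul_of_nonneg_right (by nlinarith) (abs_nonneg _)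
        rw [Real.norm_eq_abs, Real.norm_eq_abs]
        linarith [abs_add_le (a * (γ s).1 ^ m) (b * (γ s).1 ^ n * (γ s).2)]) t ht
    rw [gronwallBound_of_K_ne_0 one_ne_zero, Real.norm_eq_abs] at this
    have he : Real.exp (1 * (t - 0)) ≤ 3 := by
      have h1 := Real.exp_one_lt_d9
      have h2 : Real.exp (1 * (t - 0)) ≤ Real.exp 1 := Real.exp_le_exp.2 (by linarith [ht.2])
      linarith
    have hAd : 0 ≤ A * d ^ m := by positivity
    simp only [zero_mul, zero_add, div_one] at this
    nlinarith
  have hxd : ∀ t ∈ Icc (0 : ℝ) 1, |(γ t).1 - x₀| ≤ 2 * A * d ^ m :=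
    norm_le_of_norm_deriv_le_of_unit_time (by simp [h0])
      (fun t ht => (hx' t ht).sub_const x₀) hyb
  have hyd : ∀ t ∈ Icc (0 : ℝ) 1, |(γ t).2 - a * x₀ ^ m * t| ≤
      (|a| * (m * (9 ^ (m - 1) * (2 * A))) + B * (2 * A)) * d ^ (m + 1) := by
    refine norm_le_of_norm_deriv_le_of_unit_time (by simp [h0])
      (fun t ht => (hy' t ht).sub
        (((hasDerivAt_id t).const_mul (a * x₀ ^ m)).hasDerivWithinAt)) fun t ht => ?_
    have h1 : |(γ t).1 ^ m - x₀ ^ m| ≤ m * (9 ^ (m - 1) * (2 * A)) * d ^ (m + 1) := by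
      have hmax : max |(γ t).1| |x₀| ≤ 9 * d := max_le (hxb t ht) (by linarith)
      have hmax0 : 0 ≤ max |(γ t).1| |x₀| := le_max_of_le_right hd0
      calc |(γ t).1 ^ m - x₀ ^ m| ≤ |(γ t).1 - x₀| * m * max |(γ t).1| |x₀| ^ (m - 1) :=
            abs_pow_sub_pow_le _ _ _
        _ ≤ (2 * A * d ^ m) * m * (9 * d) ^ (m - 1) := by gcongr; exact hxd t ht
        _ = m * (9 ^ (m - 1) * (2 * A)) * (d ^ m * d ^ (m - 1)) := by rw [mul_pow]; ring
        _ ≤ m * (9 ^ (m - 1) * (2 * A)) * d ^ (m + 1) := by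
          rw [← pow_add]
          gcongr ?_ * ?_
          -- Here `m ≥ 2` is essential: `m + (m - 1) ≥ m + 1`.
          exact pow_le_pow_of_le_one hd0 hd1 (by omega)
    have h2 : |b * (γ t).1 ^ n * (γ t).2| ≤ B * (2 * A) * d ^ (m + 1) := by
      rw [abs_mul]
      calc |b * (γ t).1 ^ n| * |(γ t).2| ≤ (B * d) * (2 * A * d ^ m) :=
            mul_le_mul (hbn t ht) (hyb t ht) (abs_nonneg _) (by positivity)
        _ = _ := by ring
    have h3 : a * (γ t).1 ^ m + b * (γ t).1 ^ n * (γ t).2 - a * x₀ ^ m * 1 =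
        a * ((γ t).1 ^ m - x₀ ^ m) + b * (γ t).1 ^ n * (γ t).2 := by ring
    rw [h3]
    refine (abs_add_le _ _).trans ?_
    rw [abs_mul]
    have := mul_le_mul_of_nonneg_left h1 (abs_nonneg a)
    linarith
  have hfin := norm_le_of_norm_deriv_le_of_unit_time
    (g := fun t => (γ t).1 - (x₀ + a / 2 * x₀ ^ m * t ^ 2)) (by simp [h0])
    (fun t ht => by
      have h1 : HasDerivAt (fun t : ℝ => x₀ + a / 2 * x₀ ^ m * t ^ 2)
          (a * x₀ ^ m * t) t := by
        have := ((hasDerivAt_pow 2 t).const_mul (a / 2 * x₀ ^ m)).const_add x₀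
        refine this.congr_deriv ?_
        push_cast
        ring
      exact (hx' t ht).sub h1.hasDerivWithinAt) hyd 1 (by simp)
  simpa using hfin

/-- The characteristic map agrees near `0` with the first component of the unit-time map on the
`x`-axis. -/
theorem characteristicMap_eventuallyEq {a b : ℝ} {m n : ℕ} {U : ℝ × ℝ → ℝ × ℝ} {f : ℝ → ℝ}
    (hf : IsCharacteristicCurve (cuspField a b m n) f) :
    ∀ᶠ x in 𝓝 (0 : ℝ), characteristicMap U f x = (U (x, 0)).1 := by
  filter_upwards [hf.2.2] with x hx
  have : f x = 0 := hx
  simp [characteristicMap, this]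

theorem eventually_exists_integralCurve_axis {a b : ℝ} {m n : ℕ} {U : ℝ × ℝ → ℝ × ℝ}
    (hU : IsUnitTimeMap (cuspField a b m n) U) :
    ∀ᶠ x in 𝓝 (0 : ℝ), ∃ γ : ℝ → ℝ × ℝ, γ 0 = (x, 0) ∧
      IsIntegralCurveOn γ (fun _ => cuspField a b m n) (Icc 0 1) ∧ γ 1 = U (x, 0) := by
  have hcont : Tendsto (fun x : ℝ => (x, (0 : ℝ))) (𝓝 0) (𝓝 (0 : ℝ × ℝ)) := by
    have : Continuous (fun x : ℝ => (x, (0 : ℝ))) := by fun_prop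
    exact this.tendsto' 0 0 (by simp)
  exact hcont.eventually hU

theorem hasExpansion_characteristicMap {a b : ℝ} {m n : ℕ} (hm : 2 ≤ m) (hn : 1 ≤ n)
    {U : ℝ × ℝ → ℝ × ℝ} {f : ℝ → ℝ} (hU : IsUnitTimeMap (cuspField a b m n) U)
    (hf : IsCharacteristicCurve (cuspField a b m n) f) :
    HasExpansion (characteristicMap U f) (a / 2) m := by
  obtain ⟨M, r, hr, hM⟩ := exists_displacement_bound a b hm hn
  refine IsBigO.of_bound M ?_
  filter_upwards [characteristicMap_eventuallyEq hf, eventually_exists_integralCurve_axis hU,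
    Metric.ball_mem_nhds (0 : ℝ) hr] with x hx ⟨γ, h0, hγ, h1⟩ hxr
  rw [hx, ← h1, Real.norm_eq_abs, Real.norm_eq_abs, abs_pow]
  exact hM x (by simpa using hxr) γ h0 hγ

/-- Needed to invert the characteristic map on a repelling side by the intermediate value theorem.
Being the endpoint of a trajectory already makes `U` Lipschitz in the initial point. -/
theorem exists_continuousOn_characteristicMap {a b : ℝ} {m n : ℕ} (hm : 2 ≤ m) (hn : 1 ≤ n)
    {U : ℝ × ℝ → ℝ × ℝ} {f : ℝ → ℝ} (hU : IsUnitTimeMap (cuspField a b m n) U)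
    (hf : IsCharacteristicCurve (cuspField a b m n) f) :
    ∃ r : ℝ, 0 < r ∧ ContinuousOn (characteristicMap U f) (Ioo (-r) r) := by
  obtain ⟨ρ, hρ, hρ1, hslow⟩ := exists_norm_cuspField_le a b hm hn
  obtain ⟨K, s, hs, hK⟩ :=
    (contDiff_cuspField a b m n).contDiffAt.exists_lipschitzOnWith (x := (0 : ℝ × ℝ))
  obtain ⟨σ, hσ, hball⟩ := Metric.nhds_basis_closedBall.mem_iff.1 hs
  have hmin : 0 < min ρ σ / 9 := by positivity
  obtain ⟨r, hr, hev⟩ := Metric.eventually_nhds_iff_ball.1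
    ((characteristicMap_eventuallyEq (U := U) hf).and
      ((eventually_exists_integralCurve_axis hU).and (Metric.ball_mem_nhds (0 : ℝ) hmin)))
  refine ⟨r, hr, LipschitzOnWith.continuousOn (K := ⟨Real.exp K, (Real.exp_pos _).le⟩)
    (LipschitzOnWith.of_dist_le_mul fun x hx y hy => ?_)⟩
  have hball' : Metric.ball (0 : ℝ) r = Ioo (-r) r := by simp [Real.ball_eq_Ioo]
  obtain ⟨hCx, ⟨γ, hγ0, hγ, hγ1⟩, hxr⟩ := hev x (hball' ▸ hx)
  obtain ⟨hCy, ⟨η, hη0, hη, hη1⟩, hyr⟩ := hev y (hball' ▸ hy)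
  have stay : ∀ (z : ℝ) (ζ : ℝ → ℝ × ℝ), z ∈ Metric.ball (0 : ℝ) (min ρ σ / 9) → ζ 0 = (z, 0) →
      IsIntegralCurveOn ζ (fun _ => cuspField a b m n) (Icc 0 1) →
      ∀ t ∈ Icc (0 : ℝ) 1, ζ t ∈ s := by
    intro z ζ hz h0 hζ t ht
    have hz' : |z| < min ρ σ / 9 := by simpa using hz
    have hn0 : ‖ζ 0‖ = |z| := by simp [h0, Prod.norm_def]
    have h1 := norm_integralCurve_le hslow hζ
      (by rw [hn0]; linarith [min_le_left ρ σ]) t ht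
    refine hball ?_
    rw [mem_closedBall_zero_iff]
    rw [hn0] at h1
    linarith [min_le_right ρ σ]
  have h := dist_integralCurve_le hK hγ hη (stay x γ hxr hγ0 hγ) (stay y η hyr hη0 hη)
  rw [hCx, hCy, ← hγ1, ← hη1]
  refine (le_max_left _ _).trans (h.trans (le_of_eq ?_))
  rw [hγ0, hη0, Prod.dist_eq, dist_self, max_eq_left dist_nonneg]
  rfl

/-! ### Box dimension from two-sided estimates of the thickenings -/

/-- The quotient defining the `s`-content is comparable to `ε ^ (s - d)`: it tends to `0` for `s >
d` and stays at least `κ` for `s ≤ d`. Both infima are therefore taken over `Ioi d`. -/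
theorem hasBoxDim_of_thickening_bounds {A : Set ℝ} (hA : Bornology.IsBounded A) {d κ M : ℝ}
    (hd : 0 < d) (hκ : 0 < κ)
    (hlow : ∀ᶠ ε in 𝓝[>] (0 : ℝ),
      ENNReal.ofReal (κ * ε ^ (1 - d)) ≤ volume (Metric.thickening ε A))
    (hupp : ∀ᶠ ε in 𝓝[>] (0 : ℝ),
      volume (Metric.thickening ε A) ≤ ENNReal.ofReal (M * ε ^ (1 - d))) :
    HasBoxDim A d := by
  have hratio : ∀ (s c : ℝ) {ε : ℝ}, 0 < ε →
      ENNReal.ofReal (c * ε ^ (1 - d)) / ENNReal.ofReal (ε ^ (1 - s)) =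
        ENNReal.ofReal (c * ε ^ (s - d)) := by
    intro s c ε hε
    rw [← ENNReal.ofReal_div_of_pos (Real.rpow_pos_of_pos hε _), mul_div_assoc,
      ← Real.rpow_sub hε]
    congr 3
    ring
  have hzero : ∀ s, d < s → Tendsto (fun ε : ℝ =>
      volume (Metric.thickening ε A) / ENNReal.ofReal (ε ^ (1 - s))) (𝓝[>] 0) (𝓝 0) := by
    intro s hs
    have h1 : Tendsto (fun ε : ℝ => M * ε ^ (s - d)) (𝓝[>] 0) (𝓝 0) := by
      have h2 : ContinuousAt (fun ε : ℝ => M * ε ^ (s - d)) 0 :=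
        continuousAt_const.mul (Real.continuousAt_rpow_const 0 _ (Or.inr (by linarith)))
      have h3 := h2.tendsto
      rw [Real.zero_rpow (by linarith), mul_zero] at h3
      exact h3.mono_left nhdsWithin_le_nhds
    have h4 := ENNReal.tendsto_ofReal h1
    rw [ENNReal.ofReal_zero] at h4
    refine tendsto_of_tendsto_of_tendsto_of_le_of_le' tendsto_const_nhds h4
      (Eventually.of_forall fun _ => bot_le) ?_
    filter_upwards [hupp, self_mem_nhdsWithin] with ε h hε
    rw [← hratio s M hε]
    exact ENNReal.div_le_div_right h _
  have hpos : ∀ s, s ≤ d → ENNReal.ofReal κ ≤ lowerMinkowskiContent s A := by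
    intro s hs
    refine le_liminf_of_le (by isBoundedDefault) ?_
    filter_upwards [hlow, self_mem_nhdsWithin, Ioo_mem_nhdsGT (zero_lt_one' ℝ)] with ε h hε hε1
    refine le_trans ?_ (ENNReal.div_le_div_right h _)
    rw [hratio s κ hε]
    refine ENNReal.ofReal_le_ofReal (le_mul_of_one_le_right hκ.le ?_)
    exact Real.one_le_rpow_of_pos_of_le_one_of_nonpos hε1.1 hε1.2.le (by linarith)
  have hle : ∀ s, lowerMinkowskiContent s A ≤ upperMinkowskiContent s A := fun s =>
    liminf_le_limsup
  have hκ' : 0 < ENNReal.ofReal κ := ENNReal.ofReal_pos.2 hκ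
  have hL : {s : ℝ | 0 < s ∧ lowerMinkowskiContent s A = 0} = Ioi d := by
    ext s
    refine ⟨fun h => ?_, fun h => ⟨hd.trans h, (hzero s h).liminf_eq⟩⟩
    by_contra hs
    exact (hκ'.trans_le (hpos s (not_lt.1 hs))).ne' h.2
  have hU : {s : ℝ | 0 < s ∧ upperMinkowskiContent s A = 0} = Ioi d := by
    ext s
    refine ⟨fun h => ?_, fun h => ⟨hd.trans h, (hzero s h).limsup_eq⟩⟩
    by_contra hs
    exact (hκ'.trans_le ((hpos s (not_lt.1 hs)).trans (hle s))).ne' h.2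
  refine ⟨hA, ?_, ?_⟩
  · rw [lowerBoxDim, hL, csInf_Ioi]
  · rw [upperBoxDim, hU, csInf_Ioi]

theorem HasBoxDim.unique {A : Set ℝ} {d e : ℝ} (hd : HasBoxDim A d) (he : HasBoxDim A e) :
    d = e := hd.2.1.symm.trans he.2.1

theorem volume_thickening_neg_preimage (ε : ℝ) (A : Set ℝ) :
    volume (Metric.thickening ε (Neg.neg ⁻¹' A)) = volume (Metric.thickening ε A) := by
  rw [← (Measure.measurePreserving_neg (volume : Measure ℝ)).measure_preimage
    Metric.isOpen_thickening.measurableSet.nullMeasurableSet (s := Metric.thickening ε A)]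
  congr 1
  ext x
  simp only [Metric.mem_thickening_iff, mem_preimage]
  constructor
  · rintro ⟨z, hz, h⟩
    exact ⟨-z, hz, by rwa [dist_neg_neg]⟩
  · rintro ⟨z, hz, h⟩
    exact ⟨-z, by simpa using hz, by rw [← dist_neg_neg, neg_neg]; exact h⟩

theorem HasBoxDim.neg_preimage {A : Set ℝ} {d : ℝ} (h : HasBoxDim A d) :
    HasBoxDim (Neg.neg ⁻¹' A) d := by
  refine ⟨?_, ?_, ?_⟩
  · obtain ⟨R, hR⟩ := isBounded_iff_forall_norm_le.1 h.1
    exact isBounded_iff_forall_norm_le.2 ⟨R, fun x hx => by simpa using hR (-x) hx⟩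
  · simpa only [lowerBoxDim, lowerMinkowskiContent, volume_thickening_neg_preimage] using h.2.1
  · simpa only [upperBoxDim, upperMinkowskiContent, volume_thickening_neg_preimage] using h.2.2

/-! ### Sequences that decrease to zero with power-law gaps -/

section PowerLawGaps

variable {x : ℕ → ℝ} {q J : ℕ} {c₁ c₂ : ℝ}

theorem antitone_tail_of_gaps (hc₁ : 0 < c₁) (hpos : ∀ j, J ≤ j → 0 < x j)
    (hgap : ∀ j, J ≤ j → c₁ * x (j + 1) ^ (q + 1) ≤ x j - x (j + 1)) :
    ∀ i j, J ≤ i → i ≤ j → x j ≤ x i := by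
  intro i j hi hij
  induction j, hij using Nat.le_induction with
  | base => exact le_rfl
  | succ j hij ih =>
    have h1 := hpos (j + 1) (by omega)
    have h2 : 0 < c₁ * x (j + 1) ^ (q + 1) := by positivity
    linarith [hgap j (by omega)]

/-- The inverse powers of the terms grow at least linearly. -/
theorem linear_growth_of_gaps (hq : 1 ≤ q) (hc₁ : 0 < c₁) (hpos : ∀ j, J ≤ j → 0 < x j)
    (hgap : ∀ j, J ≤ j → c₁ * x (j + 1) ^ (q + 1) ≤ x j - x (j + 1)) (i : ℕ) :
    c₁ / (1 + c₁ * x J ^ q) * i ≤ (x (J + i) ^ q)⁻¹ := by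
  have hJ := hpos J le_rfl
  induction i with
  | zero => simp only [Nat.cast_zero, mul_zero, add_zero]; positivity
  | succ i ih =>
    have hi := hpos (J + i) (by omega)
    have hi1 := hpos (J + i + 1) (by omega)
    have hs : x (J + i + 1) ^ q ≤ x J ^ q :=
      pow_le_pow_left₀ hi1.le (antitone_tail_of_gaps hc₁ hpos hgap J _ le_rfl (by omega)) q
    have hs0 : 0 < x (J + i + 1) ^ q := by positivity
    have hg := hgap (J + i) (by omega)
    have h1 : x (J + i + 1) * (1 + c₁ * x (J + i + 1) ^ q) ≤ x (J + i) := by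
      rw [pow_succ] at hg; linarith
    rw [← add_assoc]
    set s := x (J + i + 1) ^ q with hsdef
    -- A crude Bernoulli inequality suffices. Taking inverses, each step raises the inverse power by
    -- at least `c₁ / (1 + c₁ * s)`.
    have h2 : s * (1 + c₁ * s) ≤ x (J + i) ^ q := by
      calc s * (1 + c₁ * s) ≤ s * (1 + c₁ * s) ^ q := by
            gcongr
            exact le_self_pow₀ (by nlinarith) (by omega)
        _ = (x (J + i + 1) * (1 + c₁ * s)) ^ q := by rw [mul_pow]
        _ ≤ x (J + i) ^ q := by gcongr
    have h3 : (x (J + i) ^ q)⁻¹ ≤ (s * (1 + c₁ * s))⁻¹ := by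
      gcongr
    have h4 : (s * (1 + c₁ * s))⁻¹ = s⁻¹ - c₁ / (1 + c₁ * s) := by
      field_simp
      ring
    have h5 : c₁ / (1 + c₁ * x J ^ q) ≤ c₁ / (1 + c₁ * s) := by gcongr
    push_cast
    linarith

/-- With `ε = δ ^ (q + 1)`, gaps below the level `δ / (c₂ + 1)` are at most `ε`, so the
neighbourhood fills the whole interval from `0` to that level. -/
theorem thickening_lower_of_gaps (hc₂ : 0 < c₂) (hpos : ∀ j, J ≤ j → 0 < x j)
    (hlim : Tendsto x atTop (𝓝 0))
    (hgap : ∀ j, J ≤ j → x j - x (j + 1) ≤ c₂ * x (j + 1) ^ (q + 1)) {δ : ℝ}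
    (hδ1 : δ ≤ 1) (hδJ : δ ≤ x J) :
    ENNReal.ofReal (1 / (c₂ + 1) * δ) ≤ volume (Metric.thickening (δ ^ (q + 1)) (range x)) := by
  have hsub : Ioo 0 (1 / (c₂ + 1) * δ) ⊆ Metric.thickening (δ ^ (q + 1)) (range x) := by
    intro z hz
    have hκ : 0 < 1 / (c₂ + 1) := by positivity
    have hκ1 : 1 / (c₂ + 1) ≤ 1 := by rw [div_le_one (by positivity)]; linarith
    have hδ : 0 < δ := by
      by_contra h
      have := hz.1.trans hz.2
      nlinarith
    have hzδ : z < δ := by nlinarith [hz.2]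
    have hex : ∃ j, J ≤ j ∧ x j ≤ z := by
      obtain ⟨j, h1, h2⟩ :=
        ((eventually_ge_atTop J).and (hlim.eventually (eventually_le_nhds hz.1))).exists
      exact ⟨j, h1, h2⟩
    -- The first term from index `J` on that is at most `z` is not `x J`, because `z < δ ≤ x J`;
    -- hence its predecessor lies above `z`.
    classical
    obtain ⟨hj1, hj2⟩ := Nat.find_spec hex
    have hmin := fun i => Nat.find_min (m := i) hex
    set j := Nat.find hex with hj
    have hjJ : j ≠ J := by
      intro h
      rw [h] at hj2
      linarith
    obtain ⟨i, hi⟩ : ∃ i, j = i + 1 := ⟨j - 1, by omega⟩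
    have hi1 : J ≤ i := by omega
    have hi2 : z < x i := by
      by_contra h
      exact hmin i (by omega) ⟨hi1, not_lt.1 h⟩
    refine Metric.mem_thickening_iff.2 ⟨x j, mem_range_self j, ?_⟩
    rw [Real.dist_eq, abs_of_nonneg (by linarith)]
    have h0 : 0 < x (i + 1) := hpos _ (by omega)
    have hg := hgap i hi1
    rw [hi] at hj2 ⊢
    calc z - x (i + 1) < x i - x (i + 1) := by linarith
      _ ≤ c₂ * x (i + 1) ^ (q + 1) := hg
      _ ≤ c₂ * (1 / (c₂ + 1) * δ) ^ (q + 1) := by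
        gcongr
        linarith [hz.2]
      _ = (c₂ * (1 / (c₂ + 1)) ^ (q + 1)) * δ ^ (q + 1) := by rw [mul_pow]; ring
      _ ≤ 1 * δ ^ (q + 1) := by
        gcongr
        calc c₂ * (1 / (c₂ + 1)) ^ (q + 1) ≤ c₂ * (1 / (c₂ + 1)) := by
              gcongr
              exact pow_le_of_le_one hκ.le hκ1 (by omega)
          _ ≤ 1 := by rw [mul_one_div, div_le_one (by positivity)]; linarith
      _ = δ ^ (q + 1) := one_mul _
  calc ENNReal.ofReal (1 / (c₂ + 1) * δ) = volume (Ioo 0 (1 / (c₂ + 1) * δ)) := by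
        rw [Real.volume_Ioo, sub_zero]
    _ ≤ _ := measure_mono hsub

/-- Linear growth of the inverse powers puts all terms below `δ` after `O(δ ^ (-q))` steps. The
earlier terms are covered by balls of total length `O(δ ^ (-q) * δ ^ (q + 1)) = O(δ)`, the later
ones by one interval. -/
theorem thickening_upper_of_gaps (hq : 1 ≤ q) (hc₁ : 0 < c₁) (hpos : ∀ j, J ≤ j → 0 < x j)
    (hgap : ∀ j, J ≤ j → c₁ * x (j + 1) ^ (q + 1) ≤ x j - x (j + 1)) {δ : ℝ} (hδ : 0 < δ)
    (hδ1 : δ ≤ 1) :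
    volume (Metric.thickening (δ ^ (q + 1)) (range x)) ≤
      ENNReal.ofReal ((5 + 2 * J + 2 * (c₁ / (1 + c₁ * x J ^ q))⁻¹) * δ) := by
  have hJ := hpos J le_rfl
  set κ := c₁ / (1 + c₁ * x J ^ q) with hκdef
  have hκ : 0 < κ := by positivity
  set i := ⌈κ⁻¹ * (δ ^ q)⁻¹⌉₊ with hi
  set ε := δ ^ (q + 1) with hε
  have hε0 : 0 < ε := by positivity
  have hεδ : ε ≤ δ := pow_le_of_le_one hδ.le hδ1 (by omega)
  have hxi : x (J + i) ≤ δ := by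
    have h1 := linear_growth_of_gaps hq hc₁ hpos hgap i
    have h2 : κ⁻¹ * (δ ^ q)⁻¹ ≤ i := Nat.le_ceil _
    have h3 : (δ ^ q)⁻¹ ≤ κ * i := by
      rw [inv_mul_le_iff₀ hκ] at h2
      exact h2
    have h4 := h3.trans h1
    have h5 := hpos (J + i) (by omega)
    rw [inv_le_inv₀ (by positivity) (by positivity)] at h4
    exact le_of_pow_le_pow_left₀ (by omega) hδ.le h4
  have hsub : Metric.thickening ε (range x) ⊆
      Ioo (-ε) (δ + ε) ∪ ⋃ j ∈ Finset.range (J + i), Metric.ball (x j) ε := by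
    intro z hz
    obtain ⟨_, ⟨j, rfl⟩, hj⟩ := Metric.mem_thickening_iff.1 hz
    by_cases h : j < J + i
    · exact Or.inr (mem_iUnion₂.2 ⟨j, Finset.mem_range.2 h, hj⟩)
    · left
      have h1 := antitone_tail_of_gaps hc₁ hpos hgap (J + i) j (by omega) (not_lt.1 h)
      have h2 := hpos j (by omega)
      rw [Real.dist_eq, abs_lt] at hj
      exact ⟨by linarith, by linarith⟩
  have hi1 : (i : ℝ) ≤ κ⁻¹ * (δ ^ q)⁻¹ + 1 := (Nat.ceil_lt_add_one (by positivity)).le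
  have hprod : (δ ^ q)⁻¹ * ε = δ := by
    rw [hε, pow_succ, ← mul_assoc, inv_mul_cancel₀ (by positivity), one_mul]
  calc volume (Metric.thickening ε (range x))
      ≤ volume (Ioo (-ε) (δ + ε)) +
          ∑ j ∈ Finset.range (J + i), volume (Metric.ball (x j) ε) :=
        (measure_mono hsub).trans ((measure_union_le _ _).trans
          (add_le_add le_rfl (measure_biUnion_finset_le _ _)))
    _ = ENNReal.ofReal (δ + 2 * ε + (J + i) * (2 * ε)) := by
        simp only [Real.volume_ball, Real.volume_Ioo, Finset.sum_const, Finset.card_range,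
          nsmul_eq_mul]
        rw [ENNReal.ofReal_add (by positivity) (by positivity),
          ENNReal.ofReal_mul (p := (J + i : ℝ)) (by positivity)]
        congr 2
        · ring
        · rw [← Nat.cast_add, ENNReal.ofReal_natCast]
    _ ≤ _ := by
        refine ENNReal.ofReal_le_ofReal ?_
        have h1 : (J + i) * (2 * ε) ≤ 2 * J * δ + 2 * κ⁻¹ * δ + 2 * δ := by
          calc ((J : ℝ) + i) * (2 * ε) ≤ (J + (κ⁻¹ * (δ ^ q)⁻¹ + 1)) * (2 * ε) := by gcongr
            _ = 2 * J * ε + 2 * κ⁻¹ * ((δ ^ q)⁻¹ * ε) + 2 * ε := by ring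
            _ ≤ 2 * J * δ + 2 * κ⁻¹ * δ + 2 * δ := by rw [hprod]; gcongr
        linarith

/-- A sequence decreasing to `0` with gaps comparable to the `(q+1)`-st powers of its terms has box
dimension `1 - 1 / (q + 1)`. -/
theorem hasBoxDim_range_of_gaps (hq : 1 ≤ q) (hc₁ : 0 < c₁) (hlim : Tendsto x atTop (𝓝 0))
    (hpos : ∀ j, J ≤ j → 0 < x j)
    (hgap₁ : ∀ j, J ≤ j → c₁ * x (j + 1) ^ (q + 1) ≤ x j - x (j + 1))
    (hgap₂ : ∀ j, J ≤ j → x j - x (j + 1) ≤ c₂ * x (j + 1) ^ (q + 1)) :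
    HasBoxDim (range x) (1 - 1 / ((q + 1 : ℕ) : ℝ)) := by
  have hc₂ : 0 < c₂ := by
    have h1 := hpos (J + 1) (by omega)
    have h2 : c₁ * x (J + 1) ^ (q + 1) ≤ c₂ * x (J + 1) ^ (q + 1) :=
      (hgap₁ J le_rfl).trans (hgap₂ J le_rfl)
    exact hc₁.trans_le (le_of_mul_le_mul_right h2 (by positivity))
  have hJ := hpos J le_rfl
  have hroot : ∀ ε : ℝ, 0 < ε → (ε ^ (1 / ((q + 1 : ℕ) : ℝ))) ^ (q + 1) = ε := fun ε hε => by
    rw [one_div]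
    exact Real.rpow_inv_natCast_pow hε.le (by omega)
  have hsmall : Tendsto (fun ε : ℝ => ε ^ (1 / ((q + 1 : ℕ) : ℝ))) (𝓝[>] 0) (𝓝 0) := by
    have he : (0 : ℝ) < 1 / ((q + 1 : ℕ) : ℝ) := by positivity
    have h2 := (Real.continuousAt_rpow_const 0 (1 / ((q + 1 : ℕ) : ℝ)) (Or.inr he.le)).tendsto
    rw [Real.zero_rpow he.ne'] at h2
    exact h2.mono_left nhdsWithin_le_nhds
  have hd : (1 : ℝ) - (1 - 1 / ((q + 1 : ℕ) : ℝ)) = 1 / ((q + 1 : ℕ) : ℝ) := by ring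
  have hev := hsmall.eventually (eventually_le_nhds (lt_min one_pos hJ))
  refine hasBoxDim_of_thickening_bounds (κ := 1 / (c₂ + 1)) (Metric.isBounded_range_of_tendsto x hlim)
    (M := 5 + 2 * J + 2 * (c₁ / (1 + c₁ * x J ^ q))⁻¹) ?_ (by positivity) ?_ ?_
  · rw [sub_pos, div_lt_one (by positivity)]
    exact_mod_cast (by omega : 1 < q + 1)
  · filter_upwards [hev, self_mem_nhdsWithin] with ε hε hε0
    have := thickening_lower_of_gaps hc₂ hpos hlim hgap₂ (hε.trans (min_le_left _ _))
      (hε.trans (min_le_right _ _))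
    rwa [hroot ε hε0, ← hd] at this
  · filter_upwards [hev, self_mem_nhdsWithin] with ε hε hε0
    have := thickening_upper_of_gaps hq hc₁ hpos hgap₁ (Real.rpow_pos_of_pos hε0 _)
      (hε.trans (min_le_left _ _))
    rwa [hroot ε hε0, ← hd] at this

end PowerLawGaps

/-! ### Orbits of a map tangent to the identity -/

section Orbits

/-- `C x - x` is `c x ^ k` on `(-ρ, ρ)`, up to an error of half that size. -/
def TangentWithin (C : ℝ → ℝ) (c : ℝ) (k : ℕ) (ρ : ℝ) : Prop :=
  ∀ x, |x| < ρ → |C x - (x + c * x ^ k)| ≤ |c| / 2 * |x| ^ k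

theorem HasExpansion.exists_tangentWithin {C : ℝ → ℝ} {c : ℝ} {k : ℕ} (h : HasExpansion C c k)
    (hc : c ≠ 0) : ∃ ρ, 0 < ρ ∧ TangentWithin C c k ρ := by
  obtain ⟨M, hM0, hM⟩ := h.exists_pos
  obtain ⟨r, hr, hb⟩ := Metric.eventually_nhds_iff_ball.1 (hM.bound)
  refine ⟨min r (|c| / 2 / M), by positivity, fun x hx => ?_⟩
  have h1 := hb x (by simpa using hx.trans_le (min_le_left _ _))
  have h2 : |x| * M < |c| / 2 := (lt_div_iff₀ hM0).1 (hx.trans_le (min_le_right _ _))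
  rw [Real.norm_eq_abs, Real.norm_eq_abs, abs_pow, pow_succ] at h1
  calc _ ≤ M * (|x| ^ k * |x|) := h1
    _ = (|x| * M) * |x| ^ k := by ring
    _ ≤ _ := by gcongr

theorem TangentWithin.mono {C : ℝ → ℝ} {c ρ ρ' : ℝ} {k : ℕ} (h : TangentWithin C c k ρ)
    (hρ : ρ' ≤ ρ) : TangentWithin C c k ρ' := fun x hx => h x (hx.trans_le hρ)

/-- Conjugation by `x ↦ -x` preserves this class of maps, so only the positive side needs study. -/
theorem TangentWithin.reflect {C : ℝ → ℝ} {c ρ : ℝ} {k : ℕ} (h : TangentWithin C c k ρ) :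
    TangentWithin (fun x => -C (-x)) (-(c * (-1) ^ k)) k ρ := by
  intro x hx
  have h1 := h (-x) (by rwa [abs_neg])
  have h2 : |(-(c * (-1) ^ k))| = |c| := by simp [abs_mul]
  rw [h2]
  rw [abs_neg] at h1
  have h3 : -C (-x) - (x + -(c * (-1) ^ k) * x ^ k) = -(C (-x) - (-x + c * (-x) ^ k)) := by
    rw [neg_pow x k]; ring
  rwa [h3, abs_neg]

theorem IsOrbitToZero.reflect {C : ℝ → ℝ} {r : ℝ} {x : ℕ → ℝ} (h : IsOrbitToZero C r x) :
    IsOrbitToZero (fun x => -C (-x)) r (fun j => -x j) := by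
  refine ⟨fun j => ⟨neg_ne_zero.2 (h.1 j).1, by rw [abs_neg]; exact (h.1 j).2⟩,
    by simpa using h.2.1.neg, ?_⟩
  simpa only [neg_neg, neg_inj] using h.2.2

theorem IsOrbitToZero.of_reflect {C : ℝ → ℝ} {r : ℝ} {x : ℕ → ℝ}
    (h : IsOrbitToZero (fun x => -C (-x)) r x) : IsOrbitToZero C r (fun j => -x j) := by
  simpa only [neg_neg] using h.reflect

variable {C : ℝ → ℝ} {c ρ : ℝ} {q : ℕ}

/-- Near `0` the displacement is at most half the distance to `0`. -/
theorem TangentWithin.exists_small (h : TangentWithin C c (q + 1) ρ) (hq : 1 ≤ q) (hρ : 0 < ρ) :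
    ∃ σ, 0 < σ ∧ σ ≤ ρ ∧ TangentWithin C c (q + 1) σ ∧ ∀ x, |x| < σ → |C x - x| ≤ |x| / 2 := by
  have hσ : 0 < min ρ (min 1 (1 / (4 * (|c| + 1)))) := by positivity
  refine ⟨_, hσ, min_le_left _ _, h.mono (min_le_left _ _), fun x hxσ => ?_⟩
  have h0 := abs_nonneg x
  have h1 : |x| < 1 := hxσ.trans_le ((min_le_right _ _).trans (min_le_left _ _))
  have h2 : |x| * (4 * (|c| + 1)) < 1 :=
    (lt_div_iff₀ (by positivity)).1 (hxσ.trans_le ((min_le_right _ _).trans (min_le_right _ _)))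
  have h3 : |x| ^ (q + 1) ≤ |x| ^ 2 := pow_le_pow_of_le_one h0 h1.le (by omega)
  have h4 := h x (hxσ.trans_le (min_le_left _ _))
  have h5 : C x - x = (C x - (x + c * x ^ (q + 1))) + c * x ^ (q + 1) := by ring
  calc |C x - x| ≤ |c| / 2 * |x| ^ (q + 1) + |c| * |x| ^ (q + 1) := by
        rw [h5]
        refine (abs_add_le _ _).trans (add_le_add h4 ?_)
        rw [abs_mul, abs_pow]
    _ = |c| * (3 / 2) * |x| ^ (q + 1) := by ring
    _ ≤ |c| * (3 / 2) * |x| ^ 2 := by gcongr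
    _ ≤ |x| / 2 := by nlinarith [abs_nonneg c]

theorem TangentWithin.pos_bounds (h : TangentWithin C c (q + 1) ρ) (hc : 0 < c) {x : ℝ}
    (hx : 0 < x) (hxρ : x < ρ) :
    c / 2 * x ^ (q + 1) ≤ C x - x ∧ C x - x ≤ 2 * c * x ^ (q + 1) := by
  have h1 := h x (by rwa [abs_of_pos hx])
  rw [abs_of_pos hc, abs_of_pos hx, abs_le] at h1
  have : 0 < c * x ^ (q + 1) := by positivity
  constructor <;> linarith [h1.1, h1.2]

theorem TangentWithin.neg_bounds (h : TangentWithin C c (q + 1) ρ) (hc : c < 0) {x : ℝ}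
    (hx : 0 < x) (hxρ : x < ρ) :
    |c| / 2 * x ^ (q + 1) ≤ x - C x ∧ x - C x ≤ 2 * |c| * x ^ (q + 1) := by
  have h1 := h x (by rwa [abs_of_pos hx])
  rw [abs_of_neg hc, abs_of_pos hx, abs_le] at h1
  have : 0 < -c * x ^ (q + 1) := mul_pos (by linarith) (by positivity)
  rw [abs_of_neg hc]
  constructor <;> linarith [h1.1, h1.2]

/-- An eventually nondecreasing sequence of positive terms does not tend to `0`. -/
theorem not_tendsto_zero_of_pos_of_le {x : ℕ → ℝ} {J : ℕ} (hpos : 0 < x J)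
    (hmono : ∀ j, J ≤ j → 0 < x j → x j ≤ x (j + 1)) : ¬ Tendsto x atTop (𝓝 0) := by
  intro hlim
  have : ∀ j, J ≤ j → x J ≤ x j := by
    intro j hj
    induction j, hj using Nat.le_induction with
    | base => exact le_rfl
    | succ j hj ih => exact ih.trans (hmono j hj (hpos.trans_le ih))
  exact absurd (ge_of_tendsto hlim ((eventually_ge_atTop J).mono this)) (not_le.2 hpos)

/-- A positive orbit that tends to `0` has box dimension `1 - 1 / (q + 1)`. -/
theorem hasBoxDim_orbit_of_pos (h : TangentWithin C c (q + 1) ρ) (hq : 1 ≤ q) (hρ : 0 < ρ)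
    (hc : c ≠ 0) {x : ℕ → ℝ} (hlim : Tendsto x atTop (𝓝 0)) (hpos : ∃ᶠ j in atTop, 0 < x j)
    (hne : ∀ j, x j ≠ 0) (horb : (∀ j, x (j + 1) = C (x j)) ∨ (∀ j, x j = C (x (j + 1)))) :
    HasBoxDim (range x) (1 - 1 / ((q + 1 : ℕ) : ℝ)) := by
  obtain ⟨σ, hσ, -, hT, hsmall⟩ := h.exists_small hq hρ
  have hball : ∀ᶠ j in atTop, |x j| < σ := by
    simpa using hlim.eventually (Metric.ball_mem_nhds (0 : ℝ) hσ)
  obtain ⟨J₀, hJ₀⟩ := eventually_atTop.1 hball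
  obtain ⟨J, hJJ₀, hJ⟩ := (frequently_atTop.1 hpos) J₀
  have hxσ : ∀ j, J ≤ j → x j < σ := fun j hj => (le_abs_self _).trans_lt (hJ₀ j (hJJ₀.trans hj))
  have hc0 : 0 < |c| := abs_pos.2 hc
  rcases horb with horb | horb
  · rcases hc.lt_or_gt with hc' | hc'
    · have hall : ∀ j, J ≤ j → 0 < x j := by
        intro j hj
        induction j, hj using Nat.le_induction with
        | base => exact hJ
        | succ j hj ih =>
          have h2 := hsmall _ (hJ₀ j (by omega))
          rw [← horb j, abs_of_pos ih, abs_le] at h2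
          linarith [h2.1]
      -- The displacement is controlled by `x j`, the gap condition by `x (j + 1)`; the factor `2 ^
      -- (q + 1)` comes from `x j ≤ 2 * x (j + 1)`.
      refine hasBoxDim_range_of_gaps (J := J) (c₁ := |c| / 2) (c₂ := 2 * |c| * 2 ^ (q + 1)) hq
        (by positivity) hlim hall (fun j hj => ?_) fun j hj => ?_
      · have h1 := (hT.neg_bounds hc' (hall j hj) (hxσ j hj)).1
        rw [← horb j] at h1
        have h3 := hall j hj
        have h4 := hall (j + 1) (by omega)
        have h2 : x (j + 1) ≤ x j := by
          have : 0 < |c| / 2 * x j ^ (q + 1) := by positivity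
          linarith
        refine le_trans ?_ h1
        gcongr
      · have h1 := (hT.neg_bounds hc' (hall j hj) (hxσ j hj)).2
        have h2 := hsmall _ (hJ₀ j (by omega))
        rw [← horb j] at h1
        rw [← horb j, abs_of_pos (hall j hj), abs_le] at h2
        have h3 := hall j hj
        calc x j - x (j + 1) ≤ 2 * |c| * x j ^ (q + 1) := h1
          _ ≤ 2 * |c| * (2 * x (j + 1)) ^ (q + 1) := by gcongr; linarith [h2.1]
          _ = _ := by rw [mul_pow]; ring
    · refine absurd hlim (not_tendsto_zero_of_pos_of_le hJ fun j hj hj0 => ?_)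
      have h1 := (hT.pos_bounds hc' hj0 (hxσ j hj)).1
      rw [← horb j] at h1
      have : 0 < c / 2 * x j ^ (q + 1) := by positivity
      linarith
  · have hall : ∀ j, J ≤ j → 0 < x j := by
      intro j hj
      induction j, hj using Nat.le_induction with
      | base => exact hJ
      | succ j hj ih =>
        -- Near `0` the map preserves signs, so a negative preimage would make `x j` negative.
        rcases (hne (j + 1)).lt_or_gt with hneg | hp
        · exfalso
          have h1 := hsmall _ (hJ₀ (j + 1) (by omega))
          rw [← horb j, abs_of_neg hneg, abs_le] at h1
          linarith [h1.2]
        · exact hp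
    rcases hc.lt_or_gt with hc' | hc'
    · refine absurd hlim (not_tendsto_zero_of_pos_of_le hJ fun j hj hj0 => ?_)
      have h4 := hall (j + 1) (by omega)
      have h1 := (hT.neg_bounds hc' h4 (hxσ (j + 1) (by omega))).1
      rw [← horb j] at h1
      have : 0 < |c| / 2 * x (j + 1) ^ (q + 1) := by positivity
      linarith
    · refine hasBoxDim_range_of_gaps (J := J) (c₁ := c / 2) (c₂ := 2 * c) hq
        (by positivity) hlim hall (fun j hj => ?_) fun j hj => ?_
      · have h4 := hall (j + 1) (by omega)
        have h1 := (hT.pos_bounds hc' h4 (hxσ (j + 1) (by omega))).1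
        rwa [← horb j] at h1
      · have h4 := hall (j + 1) (by omega)
        have h1 := (hT.pos_bounds hc' h4 (hxσ (j + 1) (by omega))).2
        rwa [← horb j] at h1

/-- Every orbit that tends to `0` has box dimension `1 - 1 / (q + 1)`. -/
theorem IsOrbitToZero.hasBoxDim (h : TangentWithin C c (q + 1) ρ) (hq : 1 ≤ q) (hρ : 0 < ρ)
    (hc : c ≠ 0) {r : ℝ} {x : ℕ → ℝ} (hx : IsOrbitToZero C r x) :
    HasBoxDim (range x) (1 - 1 / ((q + 1 : ℕ) : ℝ)) := by
  by_cases hpos : ∃ᶠ j in atTop, 0 < x j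
  · exact hasBoxDim_orbit_of_pos h hq hρ hc hx.2.1 hpos (fun j => (hx.1 j).1) hx.2.2
  · have hx' := hx.reflect
    have hpos' : ∃ᶠ j in atTop, 0 < -x j := by
      refine ((not_frequently.1 hpos).mono fun j hj => ?_).frequently
      exact neg_pos.2 ((hx.1 j).1.lt_of_le (not_lt.1 hj))
    have hd := (hasBoxDim_orbit_of_pos h.reflect hq hρ
      (neg_ne_zero.2 (mul_ne_zero hc (by simp))) hx'.2.1 hpos' (fun j => (hx'.1 j).1)
      hx'.2.2).neg_preimage
    convert hd using 1
    ext y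
    simp [neg_inj]

/-- Iterates of a map that moves points of `(0, σ)` towards `0` by a definite amount. -/
theorem iterate_tendsto_zero {g : ℝ → ℝ} {σ κ : ℝ} {k : ℕ} (hκ : 0 < κ)
    (hg : ∀ x, 0 < x → x < σ → 0 < g x ∧ κ * g x ^ k ≤ x - g x) {x₀ : ℝ} (h0 : 0 < x₀)
    (hσ : x₀ < σ) :
    (∀ j, 0 < g^[j] x₀ ∧ g^[j] x₀ ≤ x₀) ∧ Tendsto (fun j => g^[j] x₀) atTop (𝓝 0) := by
  have hdec : ∀ x, 0 < x → x < σ → g x ≤ x := fun x h1 h2 => by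
    obtain ⟨h3, h4⟩ := hg x h1 h2
    have : 0 < κ * g x ^ k := by positivity
    linarith
  have hin : ∀ j, 0 < g^[j] x₀ ∧ g^[j] x₀ ≤ x₀ := by
    intro j
    induction j with
    | zero => exact ⟨h0, le_rfl⟩
    | succ j ih =>
      rw [Function.iterate_succ_apply']
      have h2 := ih.2.trans_lt hσ
      exact ⟨(hg _ ih.1 h2).1, (hdec _ ih.1 h2).trans ih.2⟩
  refine ⟨hin, ?_⟩
  have hanti : Antitone fun j => g^[j] x₀ := antitone_nat_of_succ_le fun j => by
    rw [Function.iterate_succ_apply']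
    exact hdec _ (hin j).1 ((hin j).2.trans_lt hσ)
  have hbdd : BddBelow (range fun j => g^[j] x₀) := ⟨0, by
    rintro _ ⟨j, rfl⟩
    exact (hin j).1.le⟩
  have hlim := tendsto_atTop_ciInf hanti hbdd
  set L := ⨅ j, g^[j] x₀
  have hL0 : 0 ≤ L := ge_of_tendsto' hlim fun j => (hin j).1.le
  have hlim' : Tendsto (fun j => g^[j + 1] x₀) atTop (𝓝 L) := hlim.comp (tendsto_add_atTop_nat 1)
  -- Passing to the limit in the gap inequality needs no continuity of `g`, which may be a mere
  -- choice of preimages.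
  have h1 : κ * L ^ k ≤ L - L :=
    le_of_tendsto_of_tendsto' ((hlim'.pow k).const_mul κ) (hlim.sub hlim') fun j => by
      rw [Function.iterate_succ_apply']
      exact (hg _ (hin j).1 ((hin j).2.trans_lt hσ)).2
  have hL : L = 0 := by
    by_contra hne
    have : 0 < L := hL0.lt_of_ne (Ne.symm hne)
    have : 0 < κ * L ^ k := by positivity
    linarith
  rwa [hL] at hlim

/-- On the positive side an orbit that tends to `0` starts at every point close to `0`. -/
theorem exists_orbit_of_pos (h : TangentWithin C c (q + 1) ρ) (hq : 1 ≤ q) (hρ : 0 < ρ)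
    (hc : c ≠ 0) (hC : ContinuousOn C (Ioo (-ρ) ρ)) :
    ∃ r, 0 < r ∧ ∀ r' ≤ r, ∀ x₀, 0 < x₀ → x₀ < r' → ∃ x : ℕ → ℝ, x 0 = x₀ ∧
      IsOrbitToZero C r' x := by
  obtain ⟨σ, hσ, hσρ, hT, hsmall⟩ := h.exists_small hq hρ
  -- The step function `g` is `C` itself when `c < 0` and a right inverse of `C` when `c > 0`.
  suffices hg : ∃ g : ℝ → ℝ, ∃ κ, 0 < κ ∧
      (∀ x, 0 < x → x < σ → 0 < g x ∧ κ * g x ^ (q + 1) ≤ x - g x) ∧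
      ((∀ x, 0 < x → x < σ → g x = C x) ∨ ∀ x, 0 < x → x < σ → x = C (g x)) by
    obtain ⟨g, κ, hκ, hg, horb⟩ := hg
    refine ⟨σ, hσ, fun r' hr' x₀ h0 hx₀ => ⟨fun j => g^[j] x₀, rfl, ?_⟩⟩
    have hx₀σ := hx₀.trans_le hr'
    obtain ⟨hin, hlim⟩ := iterate_tendsto_zero hκ hg h0 hx₀σ
    refine ⟨fun j => ⟨(hin j).1.ne', ?_⟩, hlim, ?_⟩
    · rw [abs_of_pos (hin j).1]
      exact (hin j).2.trans_lt hx₀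
    · refine horb.imp (fun ho j => ?_) fun ho j => ?_
      · simp only [Function.iterate_succ_apply']
        exact ho _ (hin j).1 ((hin j).2.trans_lt hx₀σ)
      · simp only [Function.iterate_succ_apply']
        exact ho _ (hin j).1 ((hin j).2.trans_lt hx₀σ)
  have hc0 : 0 < |c| := abs_pos.2 hc
  rcases hc.lt_or_gt with hc' | hc'
  · refine ⟨C, |c| / 2, by positivity, fun x hx hxσ => ?_, Or.inl fun _ _ _ => rfl⟩
    have h1 := (hT.neg_bounds hc' hx hxσ).1
    have h2 := hsmall x (by rwa [abs_of_pos hx])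
    rw [abs_of_pos hx, abs_le] at h2
    have h3 : 0 < C x := by linarith [h2.1]
    have h4 : 0 < |c| / 2 * x ^ (q + 1) := by positivity
    refine ⟨h3, le_trans ?_ h1⟩
    gcongr
    linarith
  · have hinv : ∀ x, 0 < x → x < σ → ∃ y, 0 < y ∧ y < σ ∧ C y = x := by
      intro x hx hxσ
      have h0 : C 0 = 0 := by
        have := hsmall 0 (by simpa using hσ)
        simpa using this
      have h1 := (hT.pos_bounds hc' hx hxσ).1
      have h2 : 0 < c / 2 * x ^ (q + 1) := by positivity
      have hcont : ContinuousOn C (Icc 0 x) := hC.mono fun y hy =>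
        ⟨by linarith [hy.1], by linarith [hy.2]⟩
      obtain ⟨y, hy, hyx⟩ := intermediate_value_Icc hx.le hcont
        (show x ∈ Icc (C 0) (C x) from ⟨by linarith, by linarith⟩)
      refine ⟨y, hy.1.lt_of_ne ?_, hy.2.trans_lt hxσ, hyx⟩
      rintro rfl
      linarith
    choose! g hg0 hgσ hgC using hinv
    refine ⟨g, c / 2, by positivity, fun x hx hxσ => ⟨hg0 x hx hxσ, ?_⟩,
      Or.inr fun x hx hxσ => (hgC x hx hxσ).symm⟩
    have := (hT.pos_bounds hc' (hg0 x hx hxσ) (hgσ x hx hxσ)).1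
    rwa [hgC x hx hxσ] at this

/-- A continuous map `x + c x ^ (q + 1) + O(x ^ (q + 2))` with `c ≠ 0` has orbits of box dimension
`1 - 1 / (q + 1)`. -/
theorem TangentWithin.hasOrbitBoxDim (h : TangentWithin C c (q + 1) ρ) (hq : 1 ≤ q) (hρ : 0 < ρ)
    (hc : c ≠ 0) (hC : ContinuousOn C (Ioo (-ρ) ρ)) :
    HasOrbitBoxDim C (1 - 1 / ((q + 1 : ℕ) : ℝ)) := by
  obtain ⟨r₁, hr₁, h₁⟩ := exists_orbit_of_pos h hq hρ hc hC
  have hC' : ContinuousOn (fun x => -C (-x)) (Ioo (-ρ) ρ) :=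
    (hC.comp continuousOn_neg fun x hx => ⟨by linarith [hx.2], by linarith [hx.1]⟩).neg
  obtain ⟨r₂, hr₂, h₂⟩ := exists_orbit_of_pos h.reflect hq hρ
    (neg_ne_zero.2 (mul_ne_zero hc (by simp))) hC'
  -- The one-sided results hold for every smaller radius, hence for a common one.
  refine ⟨min r₁ r₂, lt_min hr₁ hr₂, fun x₀ hx₀ hr => ?_, fun x hx => hx.hasBoxDim h hq hρ hc⟩
  rcases hx₀.lt_or_gt with hneg | hpos
  · rw [abs_of_neg hneg] at hr
    obtain ⟨x, hx, horb⟩ := h₂ _ (min_le_right r₁ r₂) (-x₀) (neg_pos.2 hneg) hr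
    exact ⟨fun j => -x j, by simp [hx], horb.of_reflect⟩
  · rw [abs_of_pos hpos] at hr
    exact h₁ _ (min_le_left r₁ r₂) x₀ hpos hr

/-- The existence clause supplies an actual orbit, so the dimension is read off from it and the
universal clause is not vacuous. -/
theorem HasOrbitBoxDim.eq_of_tangentWithin {d : ℝ} (hd : HasOrbitBoxDim C d)
    (h : TangentWithin C c (q + 1) ρ) (hq : 1 ≤ q) (hρ : 0 < ρ) (hc : c ≠ 0) :
    d = 1 - 1 / ((q + 1 : ℕ) : ℝ) := by
  obtain ⟨r, hr, hex, hdim⟩ := hd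
  obtain ⟨x, -, hx⟩ := hex (r / 2) (by positivity) (by rw [abs_of_pos (by positivity)]; linarith)
  exact (hdim x hx).unique (hx.hasBoxDim h hq hρ hc)

end Orbits

/-! ### Multiplicity of the cusp -/

/-- Division by `x ^ k` as `x → 0⁺` leaves `|c| ≤ M x`. This makes the leading exponent of an
expansion unique. -/
theorem eq_zero_of_mul_pow_isBigO {c : ℝ} {k : ℕ}
    (h : (fun x : ℝ => c * x ^ k) =O[𝓝 0] fun x => x ^ (k + 1)) : c = 0 := by
  obtain ⟨M, hM⟩ := h.bound
  have hle : ∀ᶠ x in 𝓝[>] (0 : ℝ), |c| ≤ M * x := by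
    filter_upwards [nhdsWithin_le_nhds hM, self_mem_nhdsWithin] with x hx hx0
    have hx0' : (0 : ℝ) < x := hx0
    rw [Real.norm_eq_abs, Real.norm_eq_abs, abs_mul, abs_of_pos (pow_pos hx0' _),
      abs_of_pos (pow_pos hx0' _), pow_succ] at hx
    refine le_of_mul_le_mul_right ?_ (pow_pos hx0' k)
    linarith
  have hlim : Tendsto (fun x : ℝ => M * x) (𝓝[>] 0) (𝓝 0) := by
    have : Continuous fun x : ℝ => M * x := by fun_prop
    exact (this.tendsto' 0 0 (by simp)).mono_left nhdsWithin_le_nhds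
  exact abs_nonpos_iff.1 (ge_of_tendsto hlim hle)

theorem pow_isBigO_pow_of_le {i j : ℕ} (h : i ≤ j) :
    (fun x : ℝ => x ^ j) =O[𝓝 0] fun x => x ^ i := by
  refine IsBigO.of_bound 1 ?_
  filter_upwards [Metric.ball_mem_nhds (0 : ℝ) one_pos] with x hx
  rw [one_mul, norm_pow, norm_pow]
  exact pow_le_pow_of_le_one (norm_nonneg _) (by simpa using (mem_ball_zero_iff.1 hx).le) h

theorem hasMultiplicity_cuspField_iff {a : ℝ} (ha : a ≠ 0) (b : ℝ) (m n k : ℕ) :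
    HasMultiplicity (cuspField a b m n) k ↔ k = m := by
  constructor
  · rintro ⟨f, ⟨-, -, hf⟩, c, hc, hO⟩
    have hO' : (fun x : ℝ => a * x ^ m - c * x ^ k) =O[𝓝 0] fun x => x ^ (k + 1) := by
      refine hO.congr' ?_ EventuallyEq.rfl
      filter_upwards [hf] with x hx
      have : f x = 0 := hx
      simp [cuspField, this]
    rcases lt_trichotomy k m with hlt | heq | hgt
    · have h1 : (fun x : ℝ => a * x ^ m) =O[𝓝 0] fun x => x ^ (k + 1) :=
        (pow_isBigO_pow_of_le hlt).const_mul_left a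
      exact absurd (eq_zero_of_mul_pow_isBigO ((h1.sub hO').congr_left fun x => by ring)) hc
    · exact heq
    · have h1 : (fun x : ℝ => c * x ^ k) =O[𝓝 0] fun x => x ^ (m + 1) :=
        (pow_isBigO_pow_of_le hgt).const_mul_left c
      have h2 : (fun x : ℝ => a * x ^ m - c * x ^ k) =O[𝓝 0] fun x => x ^ (m + 1) :=
        hO'.trans (pow_isBigO_pow_of_le (by omega))
      exact absurd (eq_zero_of_mul_pow_isBigO ((h1.add h2).congr_left fun x => by ring)) ha
  · rintro rfl
    refine ⟨fun _ => 0, ⟨rfl, continuousAt_const, Eventually.of_forall fun x => rfl⟩, a, ha, ?_⟩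
    simpa [cuspField] using isBigO_zero (fun x : ℝ => x ^ (k + 1)) (𝓝 (0 : ℝ))

/-- For `a = 0` every point of the `x`-axis is singular. -/
theorem IsNilpotentSingularPoint.coeff_ne_zero {a b : ℝ} {m n : ℕ}
    (h : IsNilpotentSingularPoint (cuspField a b m n)) : a ≠ 0 := by
  rintro rfl
  obtain ⟨-, -, hiso, -⟩ := h
  have hcont : Tendsto (fun x : ℝ => (x, (0 : ℝ))) (𝓝[≠] 0) (𝓝[≠] (0 : ℝ × ℝ)) := by
    refine tendsto_nhdsWithin_of_tendsto_nhds_of_eventually_within _ ?_ ?_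
    · have : Continuous fun x : ℝ => (x, (0 : ℝ)) := by fun_prop
      exact (this.tendsto' 0 0 (by simp)).mono_left nhdsWithin_le_nhds
    · filter_upwards [self_mem_nhdsWithin] with x hx h0
      exact hx (congrArg Prod.fst h0)
  obtain ⟨x, hx⟩ := (hcont.eventually hiso).exists
  exact hx (by simp [cuspField])

theorem IsNilpotentSingularPoint.exponent_ne_zero {a b : ℝ} {m n : ℕ}
    (h : IsNilpotentSingularPoint (cuspField a b m n)) : m ≠ 0 := by
  rintro rfl
  have h0 := congrArg Prod.snd h.2.1
  exact h.coeff_ne_zero (by simpa [cuspField] using h0)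

theorem lemma3 (a b : ℝ) (m n : ℕ) (hm : Even m) (hmn : m < 2 * n + 1)
    (hcusp : IsNilpotentCusp (cuspField a b m n)) :
    (∃ U, IsUnitTimeMap (cuspField a b m n) U) ∧
    ∀ (U : ℝ × ℝ → ℝ × ℝ) (f : ℝ → ℝ), IsUnitTimeMap (cuspField a b m n) U →
      IsCharacteristicCurve (cuspField a b m n) f →
      HasExpansion (characteristicMap U f) (a / 2) m ∧
      ∀ k : ℕ, 0 < k →
        ((HasExpansion (characteristicMap U f) (a / 2) k ∧
            HasOrbitBoxDim (characteristicMap U f) (1 - 1 / (k : ℝ))) ↔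
          IsMultipleNilpotentCusp (cuspField a b m n) k) ∧
        (HasOrbitBoxDim (characteristicMap U f) (1 - 1 / (k : ℝ)) ↔
          IsMultipleNilpotentCusp (cuspField a b m n) k) := by
  have hsing := hcusp.1
  have ha : a ≠ 0 := hsing.coeff_ne_zero
  have hm2 : 2 ≤ m := by
    obtain ⟨i, hi⟩ := hm
    have := hsing.exponent_ne_zero
    omega
  -- The inequality `m < 2 * n + 1` enters here, with `m ≥ 2`.
  have hn : 1 ≤ n := by omega
  refine ⟨exists_isUnitTimeMap_cuspField a b hm2 hn, fun U f hU hf => ?_⟩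
  have hexp := hasExpansion_characteristicMap hm2 hn hU hf
  have hc : a / 2 ≠ 0 := by positivity
  obtain ⟨ρ₁, hρ₁, hT⟩ := hexp.exists_tangentWithin hc
  obtain ⟨ρ₂, hρ₂, hcont⟩ := exists_continuousOn_characteristicMap hm2 hn hU hf
  obtain ⟨q, rfl⟩ : ∃ q, m = q + 1 := ⟨m - 1, by omega⟩
  have hq : 1 ≤ q := by omega
  have hρ : 0 < min ρ₁ ρ₂ := lt_min hρ₁ hρ₂
  have hT' := hT.mono (min_le_left ρ₁ ρ₂)
  have hdim := hT'.hasOrbitBoxDim hq hρ hc (hcont.mono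
    (Ioo_subset_Ioo (neg_le_neg (min_le_right ρ₁ ρ₂)) (min_le_right ρ₁ ρ₂)))
  have hmult : ∀ k, IsMultipleNilpotentCusp (cuspField a b (q + 1) n) k ↔ k = q + 1 := fun k => by
    rw [IsMultipleNilpotentCusp, hasMultiplicity_cuspField_iff ha, and_iff_right hcusp]
  -- The value `1 - 1 / k` determines `k`, so the dimension singles out the exponent `m = q + 1`.
  have hdim_iff : ∀ k : ℕ,
      HasOrbitBoxDim (characteristicMap U f) (1 - 1 / (k : ℝ)) ↔ k = q + 1 := fun k => by
    refine ⟨fun h => ?_, fun h => h ▸ hdim⟩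
    have h1 := h.eq_of_tangentWithin hT' hq hρ hc
    rw [sub_right_inj, one_div, one_div, inv_inj] at h1
    exact_mod_cast h1
  refine ⟨hexp, fun k _ => ⟨?_, (hdim_iff k).trans (hmult k).symm⟩⟩
  rw [hmult, hdim_iff]
  exact ⟨fun h => h.2, fun h => ⟨h ▸ hexp, h⟩⟩
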